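/- Theorem. All graphs are finite and simple, and $\alpha(G)$ denotes the independence number of $G$. For an integer $n\ge 0$, a graph $H$ and a real number $a$, let $\mathbf{RT}(n,H,a)$ be the maximum number of edges in an $n$-vertex $H$-free graph $G$ with $\alpha(G)\le a$ (put $\mathbf{RT}(n,H,a)=0$ if there is no such graph). For a function $f$, let $$\overline{\rho\tau}(H,f)=\limsup_{n\to\infty}\frac{\mathbf{RT}(n,H,f(n))}{n^2}.$$ Let $\mathbf{Q}(t,n)$ be the inverse Ramsey number, i.e. the minimum independence number of a $K_t$-free graph on $n$ vertices. Then the limit $$\overline{\rho\tau}(K_9,o(\mathbf{Q}(3,n))):=\lim_{\delta\to 0^+}\overline{\rho\tau}\bigl(K_9,\delta\,\mathbf{Q}(3,n)\bigr)$$ exists and $$\overline{\rho\tau}(K_9,o(\mathbf{Q}(3,n)))\le \frac{3}{10}.$$ -/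

import Mathlib

open Filter Topology

namespace RamseyTuran

/-- The edge numbers of the `n`-vertex `H`-free graphs with independence number at most `a`. -/
def edgeNumbers {W : Type*} (n : ℕ) (H : SimpleGraph W) (a : ℝ) : Set ℕ :=
  {e | ∃ G : SimpleGraph (Fin n), H.Free G ∧ (G.indepNum : ℝ) ≤ a ∧ G.edgeSet.ncard = e}

/-- The Ramsey-Turán number `RT(n, H, a)`: the maximum number of edges in an `n`-vertex `H`-free
graph with independence number at most `a` (and `0` if there is no such graph). -/
noncomputable def RT {W : Type*} (n : ℕ) (H : SimpleGraph W) (a : ℝ) : ℕ :=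
  sSup (edgeNumbers n H a)

/-- The inverse Ramsey number `Q(t, n)`: the minimum independence number of a `K_t`-free graph on
`n` vertices. -/
noncomputable def Q (t n : ℕ) : ℕ :=
  sInf {a | ∃ G : SimpleGraph (Fin n), G.CliqueFree t ∧ G.indepNum = a}

/-- For `t ≥ 2` the minimum that defines `Q(t, n)` is attained. -/
theorem exists_indepNum_eq_Q {t : ℕ} (ht : 2 ≤ t) (n : ℕ) :
    ∃ G : SimpleGraph (Fin n), G.CliqueFree t ∧ G.indepNum = Q t n :=
  Nat.sInf_mem (s := {a | ∃ G : SimpleGraph (Fin n), G.CliqueFree t ∧ G.indepNum = a})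
    ⟨_, ⊥, SimpleGraph.cliqueFree_bot ht, rfl⟩

/-- The upper Ramsey-Turán density: the limsup of `RT(n, H, f(n)) / n ^ 2` as `n → ∞`. -/
noncomputable def upperDensity {W : Type*} (H : SimpleGraph W) (f : ℕ → ℝ) : ℝ :=
  limsup (fun n : ℕ => (RT n H (f n) : ℝ) / (n : ℝ) ^ 2) atTop

theorem le_sq_of_mem_edgeNumbers {W : Type*} {n : ℕ} {H : SimpleGraph W} {a : ℝ} {e : ℕ}
    (he : e ∈ edgeNumbers n H a) : e ≤ n ^ 2 := by
  classical
  obtain ⟨G, -, -, rfl⟩ := he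
  rw [← SimpleGraph.coe_edgeFinset, Set.ncard_coe_finset]
  refine G.card_edgeFinset_le_card_choose_two.trans ?_
  rw [Fintype.card_fin]
  exact Nat.choose_le_pow n 2

/-- The supremum that defines `RT` is over a bounded set, so it is a maximum whenever some graph is
admissible. -/
theorem bddAbove_edgeNumbers {W : Type*} (n : ℕ) (H : SimpleGraph W) (a : ℝ) :
    BddAbove (edgeNumbers n H a) :=
  ⟨n ^ 2, fun _ he => le_sq_of_mem_edgeNumbers he⟩

theorem RT_le_sq {W : Type*} (n : ℕ) (H : SimpleGraph W) (a : ℝ) : RT n H a ≤ n ^ 2 := by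
  rcases (edgeNumbers n H a).eq_empty_or_nonempty with h | h
  · simp [RT, h]
  · exact csSup_le h fun _ he => le_sq_of_mem_edgeNumbers he

/-- The sequence whose limsup is `upperDensity` takes values in `[0, 1]`, so this limsup is the
genuine one. -/
theorem RT_div_sq_mem_Icc {W : Type*} (n : ℕ) (H : SimpleGraph W) (a : ℝ) :
    (RT n H a : ℝ) / (n : ℝ) ^ 2 ∈ Set.Icc (0 : ℝ) 1 := by
  refine ⟨by positivity, div_le_one_of_le₀ ?_ (by positivity)⟩
  exact_mod_cast RT_le_sq n H a

end RamseyTuran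

namespace RamseyTuran

/-- A scheme for building a clique of order `m` from the clusters in a list, given the types `t` of
the pairs of clusters: from each cluster one, two or three vertices of a triangle are kept,
depending on the types of its pairs with the later clusters. -/
inductive CliqueScheme {ι : Type*} (t : ι → ι → ℕ) : List ι → ℕ → Prop
  | nil : CliqueScheme t [] 0
  | one {i : ι} {L : List ι} {m : ℕ} : CliqueScheme t L m → (∀ j ∈ L, 1 ≤ t i j) →
      CliqueScheme t (i :: L) (m + 1)
  | two {i j₀ : ι} {L : List ι} {m : ℕ} : CliqueScheme t L m → 2 ≤ t i j₀ →
      (∀ j ∈ L, j ≠ j₀ → 3 ≤ t i j) → CliqueScheme t (i :: L) (m + 2)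
  | three {i : ι} {L : List ι} {m : ℕ} : CliqueScheme t L m → (∀ j ∈ L, 3 ≤ t i j) →
      CliqueScheme t (i :: L) (m + 3)

/-! ### Small clique schemes -/

namespace CliqueScheme

variable {ι : Type*} {t : ι → ι → ℕ} {L : List ι} {m : ℕ}

theorem length_le (h : CliqueScheme t L m) : L.length ≤ m := by
  induction h <;> simp only [List.length_nil, List.length_cons] <;> omega

/-- Every new cluster goes in front and contributes a single vertex, for which positive types
suffice. -/
theorem extend [DecidableEq ι] (h : CliqueScheme t L m) (S : Finset ι)
    (hS : ∀ i ∈ S, ∀ j ∈ S, i ≠ j → 1 ≤ t i j) (hL : ∀ i ∈ S, ∀ j ∈ L, 1 ≤ t i j) :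
    ∃ L', (∀ j ∈ L', j ∈ S ∨ j ∈ L) ∧ CliqueScheme t L' (m + S.card) := by
  induction S using Finset.induction_on with
  | empty => exact ⟨L, fun j hj => Or.inr hj, by simpa using h⟩
  | insert a S ha ih =>
    obtain ⟨L', hL', h'⟩ := ih
      (fun i hi j hj => hS i (Finset.mem_insert_of_mem hi) j (Finset.mem_insert_of_mem hj))
      (fun i hi => hL i (Finset.mem_insert_of_mem hi))
    refine ⟨a :: L', ?_, ?_⟩
    · intro j hj
      rcases List.mem_cons.1 hj with rfl | hj
      · exact Or.inl (Finset.mem_insert_self _ _)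
      · exact (hL' j hj).imp Finset.mem_insert_of_mem id
    · rw [Finset.card_insert_of_notMem ha, ← add_assoc]
      refine h'.one fun j hj => ?_
      rcases hL' j hj with hj | hj
      · exact hS a (Finset.mem_insert_self _ _) j (Finset.mem_insert_of_mem hj)
          fun h => ha (h ▸ hj)
      · exact hL a (Finset.mem_insert_self _ _) j hj

theorem singleton (i : ι) : CliqueScheme t [i] 3 := CliqueScheme.nil.three (by simp)

theorem pair_two {i j : ι} (h : 2 ≤ t i j) : CliqueScheme t [i, j] 5 :=
  (singleton j).two h (by simp)

theorem pair_three {i j : ι} (h : 3 ≤ t i j) : CliqueScheme t [i, j] 6 :=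
  (singleton j).three (by simpa using h)

theorem triple_eight {i j k : ι} (hij : 2 ≤ t i j) (hik : 3 ≤ t i k) (hjk : 3 ≤ t j k) :
    CliqueScheme t [i, j, k] 8 :=
  (pair_three hjk).two hij (by
    intro l hl hne
    simp only [List.mem_cons, List.not_mem_nil, or_false] at hl
    rcases hl with rfl | rfl
    · exact absurd rfl hne
    · exact hik)

theorem triple_nine {i j k : ι} (hij : 3 ≤ t i j) (hik : 3 ≤ t i k) (hjk : 3 ≤ t j k) :
    CliqueScheme t [i, j, k] 9 :=
  (pair_three hjk).three (by simp [hij, hik])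

end CliqueScheme

/-! ### Quadratic forms on four clusters -/

section Quadratic

/-- A quadratic form on four vertices in which the six pairs have the given weights. -/
def quadForm (a b c d e f x y z w : ℝ) : ℝ :=
  a * (x * y) + b * (x * z) + c * (x * w) + d * (y * z) + e * (y * w) + f * (z * w)

theorem quadForm_cycle_le (x y z w : ℝ) :
    quadForm 3 1 3 3 1 3 x y z w ≤ 9 / 10 * (x + y + z + w) ^ 2 := by
  unfold quadForm
  nlinarith [sq_nonneg (x - z), sq_nonneg (y - w), sq_nonneg (x + z - y - w),
    sq_nonneg (x + y + z + w)]

theorem quadForm_star_le (x y z w : ℝ) :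
    quadForm 3 3 3 1 1 1 x y z w ≤ 9 / 10 * (x + y + z + w) ^ 2 := by
  unfold quadForm
  nlinarith [sq_nonneg (y - z), sq_nonneg (y - w), sq_nonneg (z - w),
    sq_nonneg (2 * x - (y + z + w)), sq_nonneg (x + y + z + w), sq_nonneg (y + z + w)]

/-- The maximum on the simplex is 11/13, at weights proportional to 3, 5, 3, 2; the last square in
the hint vanishes there. -/
theorem quadForm_path_le (x y z w : ℝ) (hx : 0 ≤ x) (hy : 0 ≤ y) (hz : 0 ≤ z) (hw : 0 ≤ w) :
    quadForm 3 1 2 3 2 2 x y z w ≤ 9 / 10 * (x + y + z + w) ^ 2 := by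
  unfold quadForm
  nlinarith [sq_nonneg (x - z), sq_nonneg (y - (x + z)), sq_nonneg (x + y + z - 3 * w),
    sq_nonneg (x + y + z - 5 * w), sq_nonneg (y - 5 / 6 * (x + z))]

theorem quadForm_matching_le (x y z w : ℝ) :
    quadForm 3 2 2 2 2 3 x y z w ≤ 9 / 10 * (x + y + z + w) ^ 2 := by
  unfold quadForm
  nlinarith [sq_nonneg (x - y), sq_nonneg (z - w), sq_nonneg (x + y - z - w),
    sq_nonneg (x + y + z + w)]

theorem quadForm_mono {a b c d e f a' b' c' d' e' f' x y z w : ℝ} (hx : 0 ≤ x) (hy : 0 ≤ y)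
    (hz : 0 ≤ z) (hw : 0 ≤ w)
    (h : a ≤ a' ∧ b ≤ b' ∧ c ≤ c' ∧ d ≤ d' ∧ e ≤ e' ∧ f ≤ f') :
    quadForm a b c d e f x y z w ≤ quadForm a' b' c' d' e' f' x y z w := by
  obtain ⟨ha, hb, hc, hd, he, hf⟩ := h
  unfold quadForm
  gcongr

/-- The maximal types of the pairs of four clusters in which every triple of clusters has total
type at most seven. -/
def maximalTypes : List (ℕ × ℕ × ℕ × ℕ × ℕ × ℕ) :=
  [(3, 1, 3, 3, 1, 3), (3, 3, 1, 1, 3, 3), (1, 3, 3, 3, 3, 1),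
   (3, 3, 3, 1, 1, 1), (3, 1, 1, 3, 3, 1), (1, 3, 1, 3, 1, 3), (1, 1, 3, 1, 3, 3),
   (3, 1, 2, 3, 2, 2), (3, 2, 1, 2, 3, 2), (2, 2, 2, 3, 3, 1),
   (3, 3, 2, 1, 2, 2), (3, 2, 3, 2, 1, 2), (2, 3, 3, 2, 2, 1),
   (1, 3, 2, 3, 2, 2), (2, 3, 1, 2, 2, 3), (2, 2, 2, 3, 1, 3),
   (1, 2, 3, 2, 3, 2), (2, 1, 3, 2, 2, 3), (2, 2, 2, 1, 3, 3),
   (3, 2, 2, 2, 2, 3), (2, 3, 2, 2, 3, 2), (2, 2, 3, 3, 2, 2)]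

/-- An exhaustive check; the premises stand between the quantifiers so that the search is pruned
early. -/
theorem any_maximalTypes : ∀ a b d : Fin 4, a.1 + b.1 + d.1 ≤ 7 → ∀ c e : Fin 4,
    a.1 + c.1 + e.1 ≤ 7 → ∀ f : Fin 4, b.1 + c.1 + f.1 ≤ 7 → d.1 + e.1 + f.1 ≤ 7 →
    (maximalTypes.any fun p => decide (a.1 ≤ p.1 ∧ b.1 ≤ p.2.1 ∧ c.1 ≤ p.2.2.1 ∧
      d.1 ≤ p.2.2.2.1 ∧ e.1 ≤ p.2.2.2.2.1 ∧ f.1 ≤ p.2.2.2.2.2)) = true := by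
  set_option maxRecDepth 100000 in
  decide

theorem quadForm_le_of_triples_le {a b c d e f : ℕ} {x y z w : ℝ} (hx : 0 ≤ x) (hy : 0 ≤ y)
    (hz : 0 ≤ z) (hw : 0 ≤ w) (ha : a < 4) (hb : b < 4) (hc : c < 4) (hd : d < 4) (he : e < 4)
    (hf : f < 4) (habd : a + b + d ≤ 7) (hace : a + c + e ≤ 7) (hbcf : b + c + f ≤ 7)
    (hdef : d + e + f ≤ 7) :
    quadForm a b c d e f x y z w ≤ 9 / 10 * (x + y + z + w) ^ 2 := by
  obtain ⟨p, hp, hle⟩ := List.any_eq_true.1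
    (any_maximalTypes ⟨a, ha⟩ ⟨b, hb⟩ ⟨d, hd⟩ habd ⟨c, hc⟩ ⟨e, he⟩ hace ⟨f, hf⟩ hbcf hdef)
  rw [decide_eq_true_iff] at hle
  have key : quadForm a b c d e f x y z w ≤
      quadForm p.1 p.2.1 p.2.2.1 p.2.2.2.1 p.2.2.2.2.1 p.2.2.2.2.2 x y z w :=
    quadForm_mono hx hy hz hw (by exact_mod_cast hle)
  refine key.trans ?_
  have hc (x y z w : ℝ) := quadForm_cycle_le x y z w
  have hs (x y z w : ℝ) := quadForm_star_le x y z w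
  have hm (x y z w : ℝ) := quadForm_matching_le x y z w
  have hpa := @quadForm_path_le
  unfold quadForm at hc hs hm hpa ⊢
  simp only [maximalTypes, List.mem_cons, List.not_mem_nil, or_false] at hp
  rcases hp with rfl | rfl | rfl | rfl | rfl | rfl | rfl | rfl | rfl | rfl | rfl | rfl | rfl |
    rfl | rfl | rfl | rfl | rfl | rfl | rfl | rfl | rfl <;> norm_num only [Nat.cast_ofNat, Nat.cast_one]
  -- Up to relabelling the vertices only four forms occur: 3 cycles, 4 stars, 12 paths and 3
  -- matchings, named after the pairs of type 3.
  · linarith [hc x y z w]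
  · linarith [hc x y w z]
  · linarith [hc x z y w]
  · linarith [hs x y z w]
  · linarith [hs y x z w]
  · linarith [hs z x y w]
  · linarith [hs w x y z]
  · linarith [hpa x y z w hx hy hz hw]
  · linarith [hpa x y w z hx hy hw hz]
  · linarith [hpa z y w x hz hy hw hx]
  · linarith [hpa y x z w hy hx hz hw]
  · linarith [hpa y x w z hy hx hw hz]
  · linarith [hpa z x w y hz hx hw hy]
  · linarith [hpa x z y w hx hz hy hw]
  · linarith [hpa x z w y hx hz hw hy]
  · linarith [hpa y z w x hy hz hw hx]
  · linarith [hpa x w y z hx hw hy hz]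
  · linarith [hpa x w z y hx hw hz hy]
  · linarith [hpa y w z x hy hw hz hx]
  · linarith [hm x y z w]
  · linarith [hm x z y w]
  · linarith [hm x w y z]

end Quadratic

/-! ### The weighted Turán problem -/

section WeightedTuran

variable {ι : Type*} {t : ι → ι → ℕ}

/-- Replacing every off-diagonal type by `c` leaves `c` times the square of the sum minus the sum of
squares; Cauchy–Schwarz finishes. -/
theorem card_mul_sum_sum_le [DecidableEq ι] (hdiag : ∀ i, t i i = 0) {S : Finset ι} {c : ℕ}
    (hc : ∀ i ∈ S, ∀ j ∈ S, t i j ≤ c) {x : ι → ℝ} (hx : ∀ i ∈ S, 0 ≤ x i) :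
    S.card * ∑ i ∈ S, ∑ j ∈ S, (t i j : ℝ) * (x i * x j) ≤
      c * (S.card - 1) * (∑ i ∈ S, x i) ^ 2 := by
  have h1 : ∑ i ∈ S, ∑ j ∈ S, (t i j : ℝ) * (x i * x j) ≤
      ∑ i ∈ S, ∑ j ∈ S, (c * (x i * x j) - if i = j then c * x i ^ 2 else 0) := by
    refine Finset.sum_le_sum fun i hi => Finset.sum_le_sum fun j hj => ?_
    split_ifs with h
    · subst h
      simp [hdiag, sq]
    · have : (t i j : ℝ) ≤ c := by exact_mod_cast hc i hi j hj
      have := mul_le_mul_of_nonneg_right this (mul_nonneg (hx i hi) (hx j hj))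
      linarith
  have h2 : ∑ i ∈ S, ∑ j ∈ S, (c * (x i * x j) - if i = j then c * x i ^ 2 else 0) =
      c * ((∑ i ∈ S, x i) ^ 2 - ∑ i ∈ S, x i ^ 2) := by
    simp only [Finset.sum_sub_distrib, Finset.sum_ite_eq, ← Finset.mul_sum]
    rw [← Finset.sum_filter, Finset.filter_mem_eq_inter, Finset.inter_self, ← Finset.mul_sum,
      ← Finset.sum_mul]
    ring
  have h3 : (∑ i ∈ S, x i) ^ 2 ≤ S.card * ∑ i ∈ S, x i ^ 2 := sq_sum_le_card_mul_sum_sq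
  rw [h2] at h1
  calc S.card * ∑ i ∈ S, ∑ j ∈ S, (t i j : ℝ) * (x i * x j)
      ≤ S.card * (c * ((∑ i ∈ S, x i) ^ 2 - ∑ i ∈ S, x i ^ 2)) := by gcongr
    _ = c * (S.card * (∑ i ∈ S, x i) ^ 2 - S.card * ∑ i ∈ S, x i ^ 2) := by ring
    _ ≤ c * (S.card * (∑ i ∈ S, x i) ^ 2 - (∑ i ∈ S, x i) ^ 2) := by gcongr
    _ = _ := by ring

/-- On a set of clusters whose pairs all have positive type, excluding the schemes for `K_9` bounds
the total type of the triples in any set of at least four clusters. -/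
theorem triple_le_seven (hsymm : ∀ i j, t i j = t j i) (h3 : ∀ i j, t i j ≤ 3)
    (hno : ∀ L, ¬ CliqueScheme t L 9) {i j k l : ι} (hi : 1 ≤ t l i) (hj : 1 ≤ t l j)
    (hk : 1 ≤ t l k) : t i j + t i k + t j k ≤ 7 := by
  by_contra! h
  have hij := h3 i j
  have hik := h3 i k
  have hjk := h3 j k
  have aux (i j k : ι) (hi : 1 ≤ t l i) (hj : 1 ≤ t l j) (hk : 1 ≤ t l k) (h1 : 2 ≤ t i j)
      (h2 : 3 ≤ t i k) (h3 : 3 ≤ t j k) : False :=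
    hno _ ((CliqueScheme.triple_eight h1 h2 h3).one (i := l) (by simp [hi, hj, hk]))
  have h4 := hsymm j k
  have h5 := hsymm i k
  have h6 := hsymm i j
  -- A total of at least eight leaves at most one type below 3, and that one is at least 2; it must
  -- be the first pair of the scheme.
  rcases Nat.lt_or_ge (t i j) 3 with h' | h'
  · exact aux i j k hi hj hk (by omega) (by omega) (by omega)
  rcases Nat.lt_or_ge (t i k) 3 with h' | h'
  · exact aux i k j hi hk hj (by omega) (by omega) (by omega)
  · exact aux j k i hj hk hi (by omega) (by omega) (by omega)

theorem exists_card_eq_and_pair_subset [DecidableEq ι] {S : Finset ι} {n : ℕ} (h : S.card = n + 2) {i j : ι}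
    (hi : i ∈ S) (hj : j ∈ S) (hij : i ≠ j) :
    ∃ T ⊆ S, T.card = n ∧ i ∉ T ∧ j ∉ T :=
  ⟨(S.erase i).erase j, (Finset.erase_subset _ _).trans (Finset.erase_subset _ _), by
    rw [Finset.card_erase_of_mem (Finset.mem_erase.2 ⟨hij.symm, hj⟩), Finset.card_erase_of_mem hi]
    omega, by simp, by simp⟩

/-- More clusters force smaller types, since each spare cluster adds a vertex to any scheme. Only
three clusters can attain 9/5. -/
theorem sum_sum_le_of_clique [DecidableEq ι] (hsymm : ∀ i j, t i j = t j i) (hdiag : ∀ i, t i i = 0)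
    (h3 : ∀ i j, t i j ≤ 3) (hno : ∀ L, ¬ CliqueScheme t L 9) {S : Finset ι}
    (hS : ∀ i ∈ S, ∀ j ∈ S, i ≠ j → 1 ≤ t i j) {x : ι → ℝ} (hx : ∀ i ∈ S, 0 ≤ x i) :
    ∑ i ∈ S, ∑ j ∈ S, (t i j : ℝ) * (x i * x j) ≤ 9 / 5 * (∑ i ∈ S, x i) ^ 2 := by
  have hsq : 0 ≤ (∑ i ∈ S, x i) ^ 2 := sq_nonneg _
  -- Seven clusters would give 3 + 6 = 9 vertices.
  have hcard : S.card ≤ 6 := by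
    by_contra! hlt
    obtain ⟨T, hTS, hT⟩ := Finset.exists_subset_card_eq (show 7 ≤ S.card by omega)
    obtain ⟨i, hi⟩ : T.Nonempty := Finset.card_pos.1 (by omega)
    obtain ⟨L, -, hL⟩ := (CliqueScheme.singleton (t := t) i).extend (T.erase i)
      (fun a ha b hb => hS a (hTS (Finset.mem_of_mem_erase ha)) b
        (hTS (Finset.mem_of_mem_erase hb)))
      (fun a ha b hb => by
        rw [List.mem_singleton.1 hb]
        exact hS a (hTS (Finset.mem_of_mem_erase ha)) i (hTS hi) (Finset.ne_of_mem_erase ha))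
    rw [Finset.card_erase_of_mem hi, hT] at hL
    exact hno L hL
  have hpair (n m : ℕ) (hn : S.card = n + 2) (hm : m + n = 9) (i : ι) (hi : i ∈ S) (j : ι)
      (hj : j ∈ S) (hij : i ≠ j) (h : CliqueScheme t [i, j] m) : False := by
    obtain ⟨T, hTS, hT, hiT, hjT⟩ := exists_card_eq_and_pair_subset hn hi hj hij
    obtain ⟨L, -, hL⟩ := h.extend T (fun a ha b hb => hS a (hTS ha) b (hTS hb))
      (fun a ha b hb => by
        simp only [List.mem_cons, List.not_mem_nil, or_false] at hb
        rcases hb with rfl | rfl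
        · exact hS a (hTS ha) b hi fun h => hiT (h ▸ ha)
        · exact hS a (hTS ha) b hj fun h => hjT (h ▸ ha))
    rw [hT, hm] at hL
    exact hno L hL
  have hbound (c : ℕ) (hc : ∀ i ∈ S, ∀ j ∈ S, t i j ≤ c) := card_mul_sum_sum_le hdiag hc hx
  interval_cases hn : S.card
  · simp [Finset.card_eq_zero.1 hn]
  · have := hbound 3 fun i _ j _ => h3 i j
    norm_num at this
    linarith
  · have := hbound 3 fun i _ j _ => h3 i j
    norm_num at this
    linarith
  · obtain ⟨i, j, k, hij, hik, hjk, rfl⟩ := Finset.card_eq_three.1 hn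
    have hxi := hx i (by simp)
    have hxj := hx j (by simp)
    have hxk := hx k (by simp)
    have main (p q r : ℕ) (hp : p ≤ 3) (hq : q ≤ 3) (hr : r ≤ 2) (x y z : ℝ) (hx : 0 ≤ x)
        (hy : 0 ≤ y) (hz : 0 ≤ z) :
        p * (x * y) + q * (x * z) + r * (y * z) ≤ 9 / 10 * (x + y + z) ^ 2 := by
      have h1 : (p : ℝ) * (x * y) ≤ 3 * (x * y) := by gcongr; exact_mod_cast hp
      have h2 : (q : ℝ) * (x * z) ≤ 3 * (x * z) := by gcongr; exact_mod_cast hq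
      have h3 : (r : ℝ) * (y * z) ≤ 2 * (y * z) := by gcongr; exact_mod_cast hr
      -- With 3, 3, 2 as coefficients the deficit is exactly (3x − 2(y + z))²/10 + (y − z)²/2.
      nlinarith [sq_nonneg (y - z), sq_nonneg (3 * x - 2 * (y + z))]
    have hijk : t i j ≤ 2 ∨ t i k ≤ 2 ∨ t j k ≤ 2 := by
      by_contra! h
      exact hno _ (CliqueScheme.triple_nine h.1 h.2.1 h.2.2)
    have hi' : i ∉ ({j, k} : Finset ι) := by simp [hij, hik]
    simp only [Finset.sum_insert hi', Finset.sum_pair hjk, hdiag, hsymm j i, hsymm k i, hsymm k j, Nat.cast_zero, zero_mul]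
    rcases hijk with h | h | h
    · linarith [main (t i k) (t j k) (t i j) (h3 _ _) (h3 _ _) h (x k) (x i) (x j) hxk hxi hxj]
    · linarith [main (t i j) (t j k) (t i k) (h3 _ _) (h3 _ _) h (x j) (x i) (x k) hxj hxi hxk]
    · linarith [main (t i j) (t i k) (t j k) (h3 _ _) (h3 _ _) h (x i) (x j) (x k) hxi hxj hxk]
  · obtain ⟨i, j, k, l, hij, hik, hil, hjk, hjl, hkl, rfl⟩ := Finset.card_eq_four.1 hn
    have htr (p q r s : ι) (hp : p ∈ ({i, j, k, l} : Finset ι))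
        (hq : q ∈ ({i, j, k, l} : Finset ι)) (hr : r ∈ ({i, j, k, l} : Finset ι))
        (hs : s ∈ ({i, j, k, l} : Finset ι)) (h1 : s ≠ p) (h2 : s ≠ q) (h4 : s ≠ r) :
        t p q + t p r + t q r ≤ 7 :=
      triple_le_seven hsymm h3 hno (hS s hs p hp h1) (hS s hs q hq h2) (hS s hs r hr h4)
    have key := quadForm_le_of_triples_le (hx i (by simp)) (hx j (by simp)) (hx k (by simp))
      (hx l (by simp)) (Nat.lt_succ_of_le (h3 i j)) (Nat.lt_succ_of_le (h3 i k))
      (Nat.lt_succ_of_le (h3 i l)) (Nat.lt_succ_of_le (h3 j k)) (Nat.lt_succ_of_le (h3 j l))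
      (Nat.lt_succ_of_le (h3 k l))
      (htr i j k l (by simp) (by simp) (by simp) (by simp) hil.symm hjl.symm hkl.symm)
      (htr i j l k (by simp) (by simp) (by simp) (by simp) hik.symm hjk.symm hkl)
      (htr i k l j (by simp) (by simp) (by simp) (by simp) hij.symm hjk hjl)
      (htr j k l i (by simp) (by simp) (by simp) (by simp) hij hik hil)
    unfold quadForm at key
    have hi' : i ∉ ({j, k, l} : Finset ι) := by simp [hij, hik, hil]
    have hj' : j ∉ ({k, l} : Finset ι) := by simp [hjk, hjl]
    simp only [Finset.sum_insert hi', Finset.sum_insert hj', Finset.sum_pair hkl, hdiag, hsymm j i, hsymm k i, hsymm k j, hsymm l i, hsymm l j, hsymm l k,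
      Nat.cast_zero, zero_mul]
    linarith
  -- Five clusters: a pair of type 3 gives six vertices and the other three clusters one each.
  · have := hbound 2 fun i hi j hj => by
      by_contra! h
      rcases eq_or_ne i j with rfl | hij
      · simp [hdiag] at h
      · exact hpair 3 6 rfl rfl i hi j hj hij (CliqueScheme.pair_three h)
    norm_num at this
    linarith
  -- Six clusters: a pair of type at least 2 gives five vertices and the other four clusters one
  -- each.
  · have := hbound 1 fun i hi j hj => by
      by_contra! h
      rcases eq_or_ne i j with rfl | hij
      · simp [hdiag] at h
      · exact hpair 4 5 rfl rfl i hi j hj hij (CliqueScheme.pair_two h)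
    norm_num at this
    linarith

theorem sum_sum_insert [DecidableEq ι] (hsymm : ∀ i j, t i j = t j i) (hdiag : ∀ i, t i i = 0) {S : Finset ι}
    {i : ι} (hi : i ∉ S) (x : ι → ℝ) :
    ∑ a ∈ insert i S, ∑ b ∈ insert i S, (t a b : ℝ) * (x a * x b) =
      ∑ a ∈ S, ∑ b ∈ S, (t a b : ℝ) * (x a * x b) + 2 * (x i * ∑ b ∈ S, (t i b : ℝ) * x b) := by
  simp only [Finset.sum_insert hi, Finset.sum_add_distrib, hdiag, Nat.cast_zero, zero_mul, zero_add]
  have h1 : ∑ b ∈ S, (t i b : ℝ) * (x i * x b) = x i * ∑ b ∈ S, (t i b : ℝ) * x b := by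
    rw [Finset.mul_sum]
    exact Finset.sum_congr rfl fun b _ => by ring
  have h2 : ∑ b ∈ S, (t b i : ℝ) * (x b * x i) = x i * ∑ b ∈ S, (t i b : ℝ) * x b := by
    rw [Finset.mul_sum]
    exact Finset.sum_congr rfl fun b _ => by rw [hsymm b i]; ring
  rw [h1, h2]
  ring

/-- The weighted Turán bound for systems of clusters that admit no scheme for `K_9`. -/
theorem sum_sum_le [DecidableEq ι] (hsymm : ∀ i j, t i j = t j i) (hdiag : ∀ i, t i i = 0)
    (h3 : ∀ i j, t i j ≤ 3) (hno : ∀ L, ¬ CliqueScheme t L 9) (S : Finset ι) (x : ι → ℝ)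
    (hx : ∀ i ∈ S, 0 ≤ x i) :
    ∑ i ∈ S, ∑ j ∈ S, (t i j : ℝ) * (x i * x j) ≤ 9 / 5 * (∑ i ∈ S, x i) ^ 2 := by
  induction hn : S.card generalizing S x with
  | zero => simp [Finset.card_eq_zero.1 hn]
  | succ n ih =>
    by_cases hS : ∀ i ∈ S, ∀ j ∈ S, i ≠ j → 1 ≤ t i j
    · exact sum_sum_le_of_clique hsymm hdiag h3 hno hS hx
    push Not at hS
    obtain ⟨i, hi, j, hj, hij, hlt⟩ := hS
    have hij0 : t i j = 0 := by omega
    obtain ⟨R, hiR, hjR, rfl⟩ : ∃ R : Finset ι, i ∉ R ∧ j ∉ R ∧ S = insert i (insert j R) :=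
      ⟨(S.erase i).erase j, by simp, by simp, by
        rw [Finset.insert_erase (Finset.mem_erase.2 ⟨hij.symm, hj⟩), Finset.insert_erase hi]⟩
    have hcard : (insert i R).card = n ∧ (insert j R).card = n := by
      rw [Finset.card_insert_of_notMem (by simp [hij, hiR]), Finset.card_insert_of_notMem hjR] at hn
      rw [Finset.card_insert_of_notMem hjR, Finset.card_insert_of_notMem hiR]
      omega
    have hxi := hx i (by simp)
    have hxj := hx j (by simp)
    have hxR (k) (hk : k ∈ R) : 0 ≤ x k := hx k (by simp [hk])
    -- Zykov symmetrization: as `t i j = 0`, the form is linear when weight moves between the two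
    -- clusters, so all of it may go to the one with the larger weighted degree.
    have step (i j : ι) (hi : i ∉ R) (hxi : 0 ≤ x i) (hxj : 0 ≤ x j) (hn : (insert i R).card = n) :
        ∑ a ∈ R, ∑ b ∈ R, (t a b : ℝ) * (x a * x b) +
          2 * ((x i + x j) * ∑ b ∈ R, (t i b : ℝ) * x b) ≤
        9 / 5 * (x i + x j + ∑ a ∈ R, x a) ^ 2 := by
      have hne (a) (ha : a ∈ R) : a ≠ i := fun h => hi (h ▸ ha)
      have := ih (insert i R) (Function.update x i (x i + x j)) (fun a ha => by
        rcases Finset.mem_insert.1 ha with rfl | ha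
        · simpa using add_nonneg hxi hxj
        · rw [Function.update_of_ne (hne a ha)]
          exact hxR a ha) hn
      rw [sum_sum_insert hsymm hdiag hi, Finset.sum_insert hi, Function.update_self] at this
      have hupd (a) (ha : a ∈ R) : Function.update x i (x i + x j) a = x a :=
        Function.update_of_ne (hne a ha) _ _
      have e1 : ∑ a ∈ R, ∑ b ∈ R, (t a b : ℝ) * (Function.update x i (x i + x j) a *
          Function.update x i (x i + x j) b) = ∑ a ∈ R, ∑ b ∈ R, (t a b : ℝ) * (x a * x b) :=
        Finset.sum_congr rfl fun a ha => Finset.sum_congr rfl fun b hb => by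
          rw [hupd a ha, hupd b hb]
      have e2 : ∑ b ∈ R, (t i b : ℝ) * Function.update x i (x i + x j) b =
          ∑ b ∈ R, (t i b : ℝ) * x b := Finset.sum_congr rfl fun b hb => by rw [hupd b hb]
      rw [e1, e2, Finset.sum_congr rfl hupd] at this
      exact this
    rw [sum_sum_insert hsymm hdiag (by simp [hij, hiR]), sum_sum_insert hsymm hdiag hjR,
      Finset.sum_insert hjR, Finset.sum_insert (by simp [hij, hiR]), Finset.sum_insert hjR, hij0,
      Nat.cast_zero, zero_mul, zero_add]
    rcases le_total (∑ b ∈ R, (t i b : ℝ) * x b) (∑ b ∈ R, (t j b : ℝ) * x b) with h | h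
    · have := step j i hjR hxj hxi hcard.2
      have := mul_le_mul_of_nonneg_left h hxi
      linarith
    · have := step i j hiR hxi hxj hcard.1
      have := mul_le_mul_of_nonneg_left h hxj
      linarith

end WeightedTuran

/-! ### Triangles in sets of linear size -/

section InverseRamsey

theorem Q_le_indepNum {t n : ℕ} {G : SimpleGraph (Fin n)} (hG : G.CliqueFree t) :
    Q t n ≤ G.indepNum :=
  Nat.sInf_le ⟨G, hG, rfl⟩

theorem Q_three_pos {n : ℕ} (hn : 0 < n) : 0 < Q 3 n := by
  obtain ⟨G, -, hG⟩ := exists_indepNum_eq_Q (t := 3) (by norm_num) n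
  rw [← hG]
  have : G.IsIndepSet (({⟨0, hn⟩} : Finset (Fin n)) : Set (Fin n)) := by
    simp [SimpleGraph.IsIndepSet]
  exact lt_of_lt_of_le (by simp) this.card_le_indepNum

/-- Disjoint copies of a triangle-free graph bound the inverse Ramsey number of a larger number of
vertices. -/
theorem Q_three_le_mul {n m K : ℕ} (h : n ≤ K * m) : Q 3 n ≤ K * Q 3 m := by
  classical
  obtain ⟨G, hG, hQ⟩ := exists_indepNum_eq_Q (t := 3) (by norm_num) m
  let f : Fin n → Fin K × Fin m := fun u => finProdFinEquiv.symm (Fin.castLE h u)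
  have hf : Function.Injective f :=
    finProdFinEquiv.symm.injective.comp (Fin.castLE_injective h)
  let G' : SimpleGraph (Fin n) :=
    { Adj := fun u v => (f u).1 = (f v).1 ∧ G.Adj (f u).2 (f v).2
      symm := ⟨fun u v huv => ⟨huv.1.symm, huv.2.symm⟩⟩
      loopless := ⟨fun u hu => G.loopless.irrefl _ hu.2⟩ }
  have hG' : G'.CliqueFree 3 := by
    intro s hs
    obtain ⟨a, b, c, hab, hac, hbc, rfl⟩ := SimpleGraph.is3Clique_iff.1 hs
    exact hG _ (SimpleGraph.is3Clique_triple_iff.2 ⟨hab.2, hac.2, hbc.2⟩)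
  refine (Q_le_indepNum hG').trans ?_
  obtain ⟨S, hS⟩ := G'.exists_isNIndepSet_indepNum
  rw [← hS.card_eq, mul_comm]
  have := Finset.card_le_mul_card_image_of_maps_to (s := S) (t := Finset.univ)
    (f := fun u => (f u).1) (fun _ _ => Finset.mem_univ _) (Q 3 m) (fun k _ => by
      have hinj : Set.InjOn (fun u => (f u).2)
          (({u ∈ S | (f u).1 = k} : Finset (Fin n)) : Set (Fin n)) := by
        intro u hu v hv huv
        simp only [Finset.coe_filter, Set.mem_ofPred_eq] at hu hv
        exact hf (Prod.ext (hu.2.trans hv.2.symm) huv)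
      rw [← Finset.card_image_of_injOn hinj, ← hQ]
      refine SimpleGraph.IsIndepSet.card_le_indepNum ?_
      intro a ha b hb hab hadj
      simp only [Finset.coe_image, Finset.coe_filter, Set.mem_image, Set.mem_ofPred_eq] at ha hb
      obtain ⟨u, hu, rfl⟩ := ha
      obtain ⟨v, hv, rfl⟩ := hb
      exact hS.isIndepSet hu.1 hv.1 (fun h => hab (by rw [h])) ⟨hu.2.trans hv.2.symm, hadj⟩)
  simpa using this

/-- The sets `W` of vertices that span no triangle are small when the independence number is small
compared with the inverse Ramsey number. -/
theorem exists_triangle_of_indepNum_le {n K : ℕ} (hn : 0 < n) {δ : ℝ} (hδ : δ * K < 1)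
    {G : SimpleGraph (Fin n)} (hG : (G.indepNum : ℝ) ≤ δ * Q 3 n) {W : Finset (Fin n)}
    (hW : n ≤ K * W.card) :
    ∃ x ∈ W, ∃ y ∈ W, ∃ z ∈ W, G.Adj x y ∧ G.Adj x z ∧ G.Adj y z := by
  classical
  by_contra! hno
  let e : Fin W.card → Fin n := fun u => W.equivFin.symm u
  have he : Function.Injective e := Subtype.val_injective.comp W.equivFin.symm.injective
  have heW (u) : e u ∈ W := (W.equivFin.symm u).2
  have hfree : (G.comap e).CliqueFree 3 := by
    intro s hs
    obtain ⟨a, b, c, hab, hac, hbc, rfl⟩ := SimpleGraph.is3Clique_iff.1 hs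
    exact hno _ (heW a) _ (heW b) _ (heW c) hab hac hbc
  have h1 : (G.comap e).indepNum ≤ G.indepNum := by
    obtain ⟨S, hS⟩ := (G.comap e).exists_isNIndepSet_indepNum
    rw [← hS.card_eq, ← Finset.card_image_of_injective S he]
    refine SimpleGraph.IsIndepSet.card_le_indepNum ?_
    intro a ha b hb hab hadj
    simp only [Finset.coe_image, Set.mem_image] at ha hb
    obtain ⟨u, hu, rfl⟩ := ha
    obtain ⟨v, hv, rfl⟩ := hb
    exact hS.isIndepSet hu hv (fun h => hab (by rw [h])) hadj
  -- A triangle-free `W` has independence number at least `Q 3 W.card`, which is at least `Q 3 n /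
  -- K`.
  have h2 : Q 3 n ≤ K * G.indepNum :=
    (Q_three_le_mul hW).trans (Nat.mul_le_mul_left K ((Q_le_indepNum hfree).trans h1))
  have h3 : (Q 3 n : ℝ) ≤ K * G.indepNum := by exact_mod_cast h2
  have h4 : (0 : ℝ) < Q 3 n := by exact_mod_cast Q_three_pos hn
  have h5 : (K : ℝ) * G.indepNum ≤ K * (δ * Q 3 n) := by gcongr
  nlinarith

end InverseRamsey

/-! ### Embedding cliques along schemes -/

section Embedding

variable {V : Type*}

/-- A point in k of the sets satisfies k ≤ 1 + C(k, 2). Hence among three sets denser than 1/3, two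
overlap substantially. -/
theorem card_add_card_add_card_le_one (U : Finset V) (p q r : V → Prop) [DecidablePred p]
    [DecidablePred q] [DecidablePred r] :
    (U.filter p).card + (U.filter q).card + (U.filter r).card ≤
      U.card + (U.filter fun u => p u ∧ q u).card + (U.filter fun u => p u ∧ r u).card +
        (U.filter fun u => q u ∧ r u).card := by
  simp only [Finset.card_filter, Finset.card_eq_sum_ones U, ← Finset.sum_add_distrib]
  refine Finset.sum_le_sum fun u _ => ?_
  by_cases hp : p u <;> by_cases hq : q u <;> by_cases hr : r u <;> simp [hp, hq, hr]

/-- A point lies in at most two of the sets unless it lies in all three. Hence three sets denser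
than 2/3 have a substantial common part. -/
theorem card_add_card_add_card_le_two (U : Finset V) (p q r : V → Prop) [DecidablePred p]
    [DecidablePred q] [DecidablePred r] :
    (U.filter p).card + (U.filter q).card + (U.filter r).card ≤
      U.card + U.card + (U.filter fun u => p u ∧ q u ∧ r u).card := by
  simp only [Finset.card_filter, Finset.card_eq_sum_ones U, ← Finset.sum_add_distrib]
  refine Finset.sum_le_sum fun u _ => ?_
  by_cases hp : p u <;> by_cases hq : q u <;> by_cases hr : r u <;> simp [hp, hq, hr]

variable (G : SimpleGraph V) [DecidableRel G.Adj]

/-- All large subsets of `A` and `B` span at least the proportion `(t - 1) / 3 + β` of the possible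
edges. -/
def DensePair (σ β : ℝ) (t : ℕ) (A B : Finset V) : Prop :=
  ∀ A' ⊆ A, ∀ B' ⊆ B, σ * A.card ≤ A'.card → σ * B.card ≤ B'.card →
    (((t : ℝ) - 1) / 3 + β) * (A'.card * B'.card) ≤ (G.interedges A' B').card

variable {G} {σ β : ℝ}

theorem card_interedges_eq_sum (A B : Finset V) :
    (G.interedges A B).card = ∑ v ∈ A, (B.filter (G.Adj v)).card := by
  rw [SimpleGraph.interedges_def, Finset.card_filter, Finset.sum_product]
  simp only [Finset.card_filter]

/-- Otherwise the atypical vertices would themselves form a large set of too low density to `B'`. -/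
theorem DensePair.card_atypical_le {t : ℕ} {A B A' B' : Finset V} (h : DensePair G σ β t A B)
    (hσ : 0 ≤ σ) (hA : A' ⊆ A) (hB : B' ⊆ B) (hB' : σ * B.card ≤ B'.card) :
    ((A'.filter fun v => ((B'.filter (G.Adj v)).card : ℝ) <
      (((t : ℝ) - 1) / 3 + β) * B'.card).card : ℝ) ≤ σ * A.card := by
  set D := A'.filter fun v => ((B'.filter (G.Adj v)).card : ℝ) <
      (((t : ℝ) - 1) / 3 + β) * B'.card with hD
  by_contra! hlt
  have hne : D.Nonempty := by
    rw [← Finset.card_pos]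
    have : (0 : ℝ) ≤ σ * A.card := by positivity
    exact_mod_cast this.trans_lt hlt
  have h1 := h D ((Finset.filter_subset _ _).trans hA) B' hB hlt.le hB'
  rw [card_interedges_eq_sum, Nat.cast_sum] at h1
  have h2 : ∑ v ∈ D, ((B'.filter (G.Adj v)).card : ℝ) <
      ∑ _v ∈ D, (((t : ℝ) - 1) / 3 + β) * B'.card :=
    Finset.sum_lt_sum_of_nonempty hne fun v hv => (Finset.mem_filter.1 hv).2
  rw [Finset.sum_const, nsmul_eq_mul] at h2
  linarith

variable {ι : Type*} {t : ι → ι → ℕ} {C : ι → Finset V}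

theorem exists_typical_subset (hσ : 0 ≤ σ) {i : ι} (U : ι → Finset V) (hUi : U i ⊆ C i)
    (L : List ι) (hL : ∀ j ∈ L, DensePair G σ β (t i j) (C i) (C j)) (hU : ∀ j ∈ L, U j ⊆ C j)
    (hcard : ∀ j ∈ L, σ * (C j).card ≤ (U j).card) :
    ∃ W ⊆ U i, ((U i).card : ℝ) ≤ W.card + L.length * (σ * (C i).card) ∧ ∀ v ∈ W, ∀ j ∈ L,
      (((t i j : ℝ) - 1) / 3 + β) * (U j).card ≤ ((U j).filter (G.Adj v)).card := by
  induction L with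
  | nil => exact ⟨U i, subset_rfl, by simp, by simp⟩
  | cons j L ih =>
    obtain ⟨W, hW, hWcard, hWtyp⟩ := ih (fun k hk => hL k (List.mem_cons_of_mem _ hk))
      (fun k hk => hU k (List.mem_cons_of_mem _ hk))
      (fun k hk => hcard k (List.mem_cons_of_mem _ hk))
    have hj : j ∈ j :: L := List.mem_cons_self
    have hbad := (hL j hj).card_atypical_le hσ (hW.trans hUi) (hU j hj) (hcard j hj)
    refine ⟨W.filter fun v => ¬ (((U j).filter (G.Adj v)).card : ℝ) <
      (((t i j : ℝ) - 1) / 3 + β) * (U j).card, (Finset.filter_subset _ _).trans hW, ?_, ?_⟩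
    · have := Finset.card_filter_add_card_filter_not (s := W)
        (fun v => (((U j).filter (G.Adj v)).card : ℝ) < (((t i j : ℝ) - 1) / 3 + β) * (U j).card)
      rify at this
      rw [List.length_cons]
      push_cast
      linarith
    · intro v hv k hk
      rw [Finset.mem_filter, not_lt] at hv
      rcases List.mem_cons.1 hk with rfl | hk
      · exact hv.2
      · exact hWtyp v hv.1 k hk

/-- A scheme for a clique can be carried out in clusters whose pairs are dense according to their
types, provided that every large set of vertices spans a triangle. -/
theorem CliqueScheme.exists_isNClique [DecidableEq V] (hσ : 0 < σ) (hβ : 0 < β) (hβ1 : β ≤ 1)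
    (hdense : ∀ i j, 1 ≤ t i j → DensePair G σ β (t i j) (C i) (C j))
    (htri : ∀ i, ∀ W : Finset V, σ * (C i).card ≤ W.card →
      ∃ x ∈ W, ∃ y ∈ W, ∃ z ∈ W, G.Adj x y ∧ G.Adj x z ∧ G.Adj y z)
    {L : List ι} {m : ℕ} (h : CliqueScheme t L m) (hL : L.length ≤ 9) (U : ι → Finset V)
    (hU : ∀ i ∈ L, U i ⊆ C i)
    (hcard : ∀ i ∈ L, 10 * σ * (C i).card ≤ β ^ L.length * (U i).card) :
    ∃ s : Finset V, G.IsNClique m s ∧ ∀ v ∈ s, ∃ i ∈ L, v ∈ U i := by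
  -- At most eight later clusters each discard `σ * (C i).card` vertices from a set of at least ten
  -- times that size, so the typical vertices still span a triangle.
  have triangle (i : ι) (L : List ι) (hL : (i :: L).length ≤ 9) (U : ι → Finset V)
      (hU : ∀ j ∈ i :: L, U j ⊆ C j)
      (hcard : ∀ j ∈ i :: L, 10 * σ * (C j).card ≤ β ^ (i :: L).length * (U j).card)
      (hpos : ∀ j ∈ L, 1 ≤ t i j) :
      ∃ x ∈ U i, ∃ y ∈ U i, ∃ z ∈ U i, G.Adj x y ∧ G.Adj x z ∧ G.Adj y z ∧
        ∀ v ∈ ({x, y, z} : Finset V), ∀ j ∈ L,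
          (((t i j : ℝ) - 1) / 3 + β) * (U j).card ≤ ((U j).filter (G.Adj v)).card := by
    have hcard' (j) (hj : j ∈ i :: L) : 10 * (σ * (C j).card) ≤ (U j).card := by
      have h1 : β ^ (i :: L).length * (U j).card ≤ 1 * (U j).card := by
        gcongr
        exact pow_le_one₀ hβ.le hβ1
      linarith [hcard j hj]
    have hnn (j) : 0 ≤ σ * (C j).card := by positivity
    obtain ⟨W, hWU, hW, htyp⟩ := exists_typical_subset (β := β) hσ.le U (hU i (by simp)) L
      (fun j hj => hdense i j (hpos j hj)) (fun j hj => hU j (List.mem_cons_of_mem _ hj))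
      (fun j hj => by linarith [hcard' j (List.mem_cons_of_mem _ hj), hnn j])
    have hlen : (L.length : ℝ) ≤ 8 := by
      rw [List.length_cons] at hL
      exact_mod_cast (by omega : L.length ≤ 8)
    have h2 := mul_le_mul_of_nonneg_right hlen (hnn i)
    obtain ⟨x, hx, y, hy, z, hz, hxyz⟩ := htri i W (by linarith [hcard' i (by simp), hnn i])
    refine ⟨x, hWU hx, y, hWU hy, z, hWU hz, hxyz.1, hxyz.2.1, hxyz.2.2, fun v hv => ?_⟩
    simp only [Finset.mem_insert, Finset.mem_singleton] at hv
    rcases hv with rfl | rfl | rfl <;> exact htyp _ ‹_›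
  -- The rest of the clique is sought in the common neighbourhoods of `K`; each later set shrinks by
  -- a factor no worse than `β`, which the exponent `L.length` pays for.
  have glue (i : ι) (L : List ι) (m a : ℕ) (U : ι → Finset V)
      (ih : L.length ≤ 9 → ∀ U : ι → Finset V, (∀ i ∈ L, U i ⊆ C i) →
        (∀ i ∈ L, 10 * σ * (C i).card ≤ β ^ L.length * (U i).card) →
        ∃ s : Finset V, G.IsNClique m s ∧ ∀ v ∈ s, ∃ i ∈ L, v ∈ U i)
      (hL : (i :: L).length ≤ 9) (hU : ∀ j ∈ i :: L, U j ⊆ C j)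
      (hcard : ∀ j ∈ i :: L, 10 * σ * (C j).card ≤ β ^ (i :: L).length * (U j).card)
      (K : Finset V) (hK : G.IsNClique a K) (hKU : K ⊆ U i)
      (hcommon : ∀ j ∈ L, β * (U j).card ≤ ((U j).filter fun u => ∀ v ∈ K, G.Adj v u).card) :
      ∃ s : Finset V, G.IsNClique (m + a) s ∧ ∀ v ∈ s, ∃ j ∈ i :: L, v ∈ U j := by
    obtain ⟨s, hs, hsU⟩ := ih (by simp only [List.length_cons] at hL; omega)
      (fun j => (U j).filter fun u => ∀ v ∈ K, G.Adj v u)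
      (fun j hj => (Finset.filter_subset _ _).trans (hU j (List.mem_cons_of_mem _ hj)))
      (fun j hj => by
        refine (hcard j (List.mem_cons_of_mem _ hj)).trans ?_
        rw [List.length_cons, pow_succ, mul_assoc]
        exact mul_le_mul_of_nonneg_left (hcommon j hj) (by positivity))
    have hadj (u) (hu : u ∈ s) (v) (hv : v ∈ K) : G.Adj v u := by
      obtain ⟨j, -, hj⟩ := hsU u hu
      exact (Finset.mem_filter.1 hj).2 v hv
    refine ⟨s ∪ K, ⟨?_, ?_⟩, ?_⟩
    · intro u hu v hv huv
      simp only [Finset.coe_union, Set.mem_union, Finset.mem_coe] at hu hv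
      rcases hu with hu | hu <;> rcases hv with hv | hv
      · exact hs.isClique hu hv huv
      · exact (hadj u hu v hv).symm
      · exact hadj v hv u hu
      · exact hK.isClique hu hv huv
    · rw [Finset.card_union_of_disjoint, hs.card_eq, hK.card_eq]
      exact Finset.disjoint_left.2 fun u hu hu' => G.loopless.irrefl u (hadj u hu u hu')
    · intro v hv
      rcases Finset.mem_union.1 hv with hv | hv
      · obtain ⟨j, hj, hvj⟩ := hsU v hv
        exact ⟨j, List.mem_cons_of_mem _ hj, (Finset.mem_filter.1 hvj).1⟩
      · exact ⟨i, by simp, hKU hv⟩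
  induction h generalizing U with
  | nil => exact ⟨∅, by simp, by simp⟩
  | @one i L m h hpos ih =>
    obtain ⟨x, hx, y, hy, z, hz, -, -, -, htyp⟩ := triangle i L hL U hU hcard hpos
    refine glue i L m 1 U ih hL hU hcard {x} (by simp) (by simpa using hx) fun j hj => ?_
    have h1 := htyp x (by simp) j hj
    have h2 : (1 : ℝ) ≤ t i j := by exact_mod_cast hpos j hj
    simp only [Finset.mem_singleton, forall_eq]
    refine le_trans ?_ h1
    gcongr
    linarith
  | @two i j₀ L m h h2 h3 ih =>
    obtain ⟨x, hx, y, hy, z, hz, hxy, hxz, hyz, htyp⟩ := triangle i L hL U hU hcard (fun j hj => by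
      rcases eq_or_ne j j₀ with rfl | hne
      · omega
      · have := h3 j hj hne
        omega)
    have hpair (j) (hj : j ∈ L) (hne : j ≠ j₀) (u v : V) (hu : u ∈ ({x, y, z} : Finset V))
        (hv : v ∈ ({x, y, z} : Finset V)) :
        β * (U j).card ≤ ((U j).filter fun w => G.Adj u w ∧ G.Adj v w).card := by
      have h4 : (3 : ℝ) ≤ t i j := by exact_mod_cast h3 j hj hne
      have h5 : (2 / 3 + β) * ((U j).card : ℝ) ≤ (((t i j : ℝ) - 1) / 3 + β) * (U j).card := by
        gcongr
        linarith
      have h6 := card_add_card_add_card_le_two (U j) (G.Adj u) (G.Adj v) (fun _ => True)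
      simp only [and_true, Finset.filter_true] at h6
      have h7 : (((U j).filter (G.Adj u)).card : ℝ) + ((U j).filter (G.Adj v)).card ≤
          (U j).card + ((U j).filter fun w => G.Adj u w ∧ G.Adj v w).card := by
        exact_mod_cast (by omega)
      have h8 : 0 ≤ β * ((U j).card : ℝ) := by positivity
      have h9 : (0 : ℝ) ≤ (U j).card := by positivity
      linarith [htyp u hu j hj, htyp v hv j hj]
    -- Which edge of the triangle survives is dictated by `j₀`; this is why a scheme allows only one
    -- exceptional cluster here.
    have hj₀ : j₀ ∈ L → ∃ u ∈ ({x, y, z} : Finset V), ∃ v ∈ ({x, y, z} : Finset V), G.Adj u v ∧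
        β * (U j₀).card ≤ ((U j₀).filter fun w => G.Adj u w ∧ G.Adj v w).card := by
      intro hj
      by_contra! hno
      have h4 : (2 : ℝ) ≤ t i j₀ := by exact_mod_cast h2
      have h5 : (1 / 3 + β) * ((U j₀).card : ℝ) ≤
          (((t i j₀ : ℝ) - 1) / 3 + β) * (U j₀).card := by
        gcongr
        linarith
      have h6 := card_add_card_add_card_le_one (U j₀) (G.Adj x) (G.Adj y) (G.Adj z)
      rify at h6
      linarith [htyp x (by simp) j₀ hj, htyp y (by simp) j₀ hj, htyp z (by simp) j₀ hj,
        hno x (by simp) y (by simp) hxy, hno x (by simp) z (by simp) hxz,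
        hno y (by simp) z (by simp) hyz]
    obtain ⟨u, hu, v, hv, huv, huv'⟩ : ∃ u ∈ ({x, y, z} : Finset V),
        ∃ v ∈ ({x, y, z} : Finset V), G.Adj u v ∧ (j₀ ∈ L →
          β * (U j₀).card ≤ ((U j₀).filter fun w => G.Adj u w ∧ G.Adj v w).card) := by
      by_cases hj : j₀ ∈ L
      · obtain ⟨u, hu, v, hv, huv, h⟩ := hj₀ hj
        exact ⟨u, hu, v, hv, huv, fun _ => h⟩
      · exact ⟨x, by simp, y, by simp, hxy, fun h => absurd h hj⟩
    have hsub : ({x, y, z} : Finset V) ⊆ U i := by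
      simp [Finset.insert_subset_iff, hx, hy, hz]
    refine glue i L m 2 U ih hL hU hcard {u, v} ?_ ?_ fun j hj => ?_
    · refine ⟨?_, Finset.card_pair huv.ne⟩
      rw [Finset.coe_pair, SimpleGraph.isClique_pair]
      exact fun _ => huv
    · exact Finset.insert_subset (hsub hu) (Finset.singleton_subset_iff.2 (hsub hv))
    · simp only [Finset.mem_insert, Finset.mem_singleton, forall_eq_or_imp, forall_eq]
      rcases eq_or_ne j j₀ with rfl | hne
      · exact huv' hj
      · exact hpair j hj hne u v hu hv
  | @three i L m h h3 ih =>
    obtain ⟨x, hx, y, hy, z, hz, hxy, hxz, hyz, htyp⟩ := triangle i L hL U hU hcard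
      (fun j hj => (by norm_num : 1 ≤ 3).trans (h3 j hj))
    refine glue i L m 3 U ih hL hU hcard {x, y, z}
      (SimpleGraph.is3Clique_triple_iff.2 ⟨hxy, hxz, hyz⟩)
      (by simp [Finset.insert_subset_iff, hx, hy, hz]) fun j hj => ?_
    have h4 : (3 : ℝ) ≤ t i j := by exact_mod_cast h3 j hj
    have h5 : (2 / 3 + β) * ((U j).card : ℝ) ≤ (((t i j : ℝ) - 1) / 3 + β) * (U j).card := by
      gcongr
      linarith
    have h6 := card_add_card_add_card_le_two (U j) (G.Adj x) (G.Adj y) (G.Adj z)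
    rify at h6
    simp only [Finset.mem_insert, Finset.mem_singleton, forall_eq_or_imp, forall_eq]
    have h8 : 0 ≤ β * ((U j).card : ℝ) := by positivity
    linarith [htyp x (by simp) j hj, htyp y (by simp) j hj, htyp z (by simp) j hj]

end Embedding

/-! ### Types of regular pairs and edge counting -/

section Regularity

open Finset

theorem edgeDensity_mul_card {V : Type*} {G : SimpleGraph V} [DecidableRel G.Adj]
    (A B : Finset V) : (G.edgeDensity A B : ℝ) * (#A * #B) = #(G.interedges A B) := by
  rcases eq_or_ne ((#A : ℝ) * #B) 0 with h | h
  · rw [h, mul_zero, eq_comm]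
    have : (#(G.interedges A B) : ℝ) ≤ #A * #B := by exact_mod_cast G.card_interedges_le_mul A B
    exact le_antisymm (this.trans h.le) (by positivity)
  · rw [SimpleGraph.edgeDensity_def]
    push_cast
    exact div_mul_cancel₀ _ h

variable {V : Type*} [Fintype V] [DecidableEq V] (G : SimpleGraph V) [DecidableRel G.Adj]

open Classical in
/-- The type of a pair of parts of a partition: it is `0` for pairs that are irregular or sparse,
and it grows by one each time that the density exceeds another third (up to `2 * β`). -/
noncomputable def pairType (P : Finpartition (univ : Finset V)) (σ β : ℝ) (A B : Finset V) : ℕ :=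
  if A ∈ P.parts ∧ B ∈ P.parts ∧ A ≠ B ∧ G.IsUniform σ A B then
    ⌈3 * ((G.edgeDensity A B : ℝ) - 2 * β)⌉₊ else 0

variable {G} {P : Finpartition (univ : Finset V)} {σ β : ℝ}

theorem pairType_comm (A B : Finset V) : pairType G P σ β A B = pairType G P σ β B A := by
  unfold pairType
  rw [G.edgeDensity_comm A B]
  congr 1
  rw [eq_iff_iff, G.isUniform_comm, ne_comm]
  tauto

theorem pairType_self (A : Finset V) : pairType G P σ β A A = 0 := by
  simp [pairType]

theorem pairType_le_three (hβ : 0 ≤ β) (A B : Finset V) : pairType G P σ β A B ≤ 3 := by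
  unfold pairType
  split_ifs
  · rw [Nat.ceil_le]
    have : (G.edgeDensity A B : ℝ) ≤ 1 := by exact_mod_cast G.edgeDensity_le_one A B
    push_cast
    linarith
  · omega

theorem mem_parts_of_one_le_pairType {A B : Finset V} (h : 1 ≤ pairType G P σ β A B) :
    A ∈ P.parts ∧ B ∈ P.parts := by
  unfold pairType at h
  split_ifs at h with hAB
  · exact ⟨hAB.1, hAB.2.1⟩
  · omega

/-- Type `t` means density above `(t - 1) / 3 + 2 * β`, and regularity costs at most `σ ≤ β` of it.
-/
theorem densePair_of_one_le_pairType (hσβ : σ ≤ β) {A B : Finset V}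
    (h : 1 ≤ pairType G P σ β A B) : DensePair G σ β (pairType G P σ β A B) A B := by
  unfold pairType at h ⊢
  split_ifs at h ⊢ with hAB
  · intro A' hA B' hB hA' hB'
    have h1 := hAB.2.2.2 hA hB (by rwa [mul_comm]) (by rwa [mul_comm])
    have h2 := (abs_lt.1 h1).1
    have h3 := Nat.ceil_lt_add_one (le_of_lt (Nat.ceil_pos.1 h))
    rw [← edgeDensity_mul_card]
    gcongr
    linarith
  · omega

theorem card_interedges_le_pairType (hβ : 0 ≤ β) {A B : Finset V} (hA : A ∈ P.parts)
    (hB : B ∈ P.parts) :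
    (#(G.interedges A B) : ℝ) ≤ 1 / 3 * (pairType G P σ β A B * (#A * #B)) +
      2 * β * (#A * #B) + (if A = B then (#A * #B : ℝ) else 0) +
      (if (A, B) ∈ P.nonUniforms G σ then (#A * #B : ℝ) else 0) := by
  have hle : (#(G.interedges A B) : ℝ) ≤ #A * #B := by
    exact_mod_cast G.card_interedges_le_mul A B
  have h0 : (0 : ℝ) ≤ 1 / 3 * (pairType G P σ β A B * (#A * #B)) := by positivity
  have h1 : 0 ≤ 2 * β * (#A * #B : ℝ) := by positivity
  have h2 : (0 : ℝ) ≤ #A * #B := by positivity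
  by_cases hAB : A = B
  · rw [if_pos hAB]
    split_ifs <;> linarith
  by_cases hu : G.IsUniform σ A B
  · rw [if_neg hAB, if_neg (by simp [hu]), ← edgeDensity_mul_card, pairType,
      if_pos ⟨hA, hB, hAB, hu⟩]
    have h3 := Nat.le_ceil (3 * ((G.edgeDensity A B : ℝ) - 2 * β))
    have h4 := mul_le_mul_of_nonneg_right h3 h2
    linarith
  · rw [if_neg hAB, if_pos (by simp [hA, hB, hAB, hu])]
    linarith

/-- The number of ordered adjacent pairs of vertices, bounded by the types of the pairs of parts
of a regular partition. -/
theorem two_mul_card_edgeFinset_le [Nonempty V] (hβ : 0 ≤ β) (hσ : 0 < σ)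
    (hP : P.IsEquipartition) (hreg : P.IsUniform G σ) (hparts : 1 ≤ β * #P.parts) :
    2 * (#G.edgeFinset : ℝ) ≤
      1 / 3 * ∑ A ∈ P.parts, ∑ B ∈ P.parts, (pairType G P σ β A B : ℝ) * (#A * #B) +
        (4 * β + 4 * σ) * Fintype.card V ^ 2 := by
  set n := Fintype.card V with hn
  have hk : #P.parts ≤ n := by simpa using P.card_parts_le_card
  have hk0 : 0 < #P.parts := by
    rcases Nat.eq_zero_or_pos #P.parts with h | h
    · norm_num [h] at hparts
    · exact h
  have hsum : ∑ A ∈ P.parts, (#A : ℝ) = n := by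
    rw [← Nat.cast_sum, P.sum_card_parts, card_univ]
  have hE : 2 * (#G.edgeFinset : ℝ) =
      ∑ A ∈ P.parts, ∑ B ∈ P.parts, (#(G.interedges A B) : ℝ) := by
    have h1 := Rel.card_interedges_finpartition G.Adj P P
    rw [sum_product] at h1
    have h2 : 2 * #G.edgeFinset = #(Rel.interedges G.Adj univ univ) := by
      rw [SimpleGraph.two_mul_card_edgeFinset, Rel.interedges]
      rfl
    rw [h1] at h2
    exact_mod_cast h2
  -- Since `1 ≤ β * #P.parts`, each part has at most `n / #P.parts + 1 ≤ 2 * β * n` vertices.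
  have hdiag : ∑ A ∈ P.parts, ∑ B ∈ P.parts, (if A = B then (#A * #B : ℝ) else 0) ≤
      2 * β * n ^ 2 := by
    calc ∑ A ∈ P.parts, ∑ B ∈ P.parts, (if A = B then (#A * #B : ℝ) else 0)
        = ∑ A ∈ P.parts, (#A * #A : ℝ) := by
          refine sum_congr rfl fun A hA => ?_
          rw [sum_ite_eq, if_pos hA]
      _ ≤ ∑ A ∈ P.parts, (2 * β * n * #A : ℝ) := by
          refine sum_le_sum fun A hA => ?_
          gcongr
          have h1 : #A ≤ n / #P.parts + 1 := by simpa using hP.card_part_le_average_add_one hA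
          have h2 : (#A : ℝ) ≤ n / #P.parts + 1 := by
            have h3 : ((n / #P.parts : ℕ) : ℝ) ≤ (n : ℝ) / #P.parts := Nat.cast_div_le
            have h4 : (#A : ℝ) ≤ (n / #P.parts : ℕ) + 1 := by exact_mod_cast h1
            linarith
          have h5 : (n : ℝ) / #P.parts ≤ β * n := by
            rw [div_le_iff₀ (by exact_mod_cast hk0)]
            nlinarith [Nat.cast_nonneg (α := ℝ) n]
          have h6 : (#P.parts : ℝ) ≤ n := by exact_mod_cast hk
          have h7 : β * #P.parts ≤ β * n := by gcongr
          linarith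
      _ = 2 * β * n ^ 2 := by rw [← mul_sum, hsum]; ring
  have hirr : ∑ A ∈ P.parts, ∑ B ∈ P.parts,
      (if (A, B) ∈ P.nonUniforms G σ then (#A * #B : ℝ) else 0) ≤ 4 * σ * n ^ 2 := by
    rw [← sum_product' (s := P.parts) (t := P.parts)
      (f := fun A B => if (A, B) ∈ P.nonUniforms G σ then (#A * #B : ℝ) else 0), ← sum_filter]
    have h1 : (P.parts ×ˢ P.parts).filter (fun x => (x.1, x.2) ∈ P.nonUniforms G σ) =
        P.nonUniforms G σ := by
      ext ⟨A, B⟩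
      simp only [mem_filter, mem_product, Finpartition.mk_mem_nonUniforms]
      tauto
    rw [h1]
    refine (hP.sum_nonUniforms_lt' univ_nonempty hσ hreg).le.trans ?_
    have h6 : (#P.parts : ℝ) ≤ n := by exact_mod_cast hk
    rw [card_univ, ← hn]
    calc σ * ((n : ℝ) + #P.parts) ^ 2 ≤ σ * ((n : ℝ) + n) ^ 2 := by gcongr
      _ = 4 * σ * n ^ 2 := by ring
  have hall : ∑ A ∈ P.parts, ∑ B ∈ P.parts, (2 * β * (#A * #B) : ℝ) = 2 * β * n ^ 2 := by
    simp only [← mul_sum, ← sum_mul, hsum]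
    ring
  rw [hE]
  refine (sum_le_sum fun A hA => sum_le_sum fun B hB =>
    card_interedges_le_pairType (σ := σ) hβ hA hB).trans ?_
  simp only [sum_add_distrib, ← mul_sum (a := (1 / 3 : ℝ))]
  linarith

theorem card_le_two_mul_parts_mul_card (hP : P.IsEquipartition) {A : Finset V} (hA : A ∈ P.parts) :
    Fintype.card V ≤ 2 * #P.parts * #A := by
  have h1 := hP.average_le_card_part hA
  rw [card_univ] at h1
  have h2 := (P.nonempty_of_mem_parts hA).card_pos
  have h3 : 0 < #P.parts := card_pos.2 ⟨A, hA⟩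
  have h4 := Nat.lt_mul_div_succ (Fintype.card V) h3
  have h5 : #P.parts * (Fintype.card V / #P.parts + 1) ≤ #P.parts * (2 * #A) :=
    Nat.mul_le_mul_left _ (by omega)
  linarith

end Regularity

/-! ### The density bound for `K_9`-free graphs -/

open Finset SzemerediRegularity in
/-- A `K_9`-free graph in which every set of linear size spans a triangle has density at most
`3 / 5` asymptotically. -/
theorem exists_card_edgeFinset_le_of_cliqueFree_nine {ε : ℝ} (hε : 0 < ε) (hε1 : ε ≤ 1) :
    ∃ c : ℝ, 0 < c ∧ ∃ N : ℕ, ∀ n ≥ N, ∀ (G : SimpleGraph (Fin n)) [DecidableRel G.Adj],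
      (∀ W : Finset (Fin n), c * n ≤ #W →
        ∃ x ∈ W, ∃ y ∈ W, ∃ z ∈ W, G.Adj x y ∧ G.Adj x z ∧ G.Adj y z) →
      G.CliqueFree 9 → (#G.edgeFinset : ℝ) ≤ (3 / 10 + ε) * n ^ 2 := by
  -- The counting error `4 * β + 4 * σ` is then at most `ε`. A scheme uses at most nine clusters, so
  -- `σ = β ^ 9 / 10` withstands all the shrinking, and `l` makes the pairs within parts negligible.
  set β : ℝ := ε / 8 with hβdef
  set σ : ℝ := β ^ 9 / 10 with hσdef
  set l : ℕ := ⌈1 / β⌉₊ with hldef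
  have hβ : 0 < β := by positivity
  have hβ1 : β ≤ 1 := by linarith
  have hσ : 0 < σ := by positivity
  have hσβ : σ ≤ β := by
    have : β ^ 9 ≤ β := pow_le_of_le_one hβ.le hβ1 (by norm_num)
    linarith
  have hl : 1 ≤ β * l := by
    have := Nat.le_ceil (1 / β)
    rwa [div_le_iff₀ hβ, mul_comm] at this
  have hM : (0 : ℝ) < bound σ l := by exact_mod_cast bound_pos σ l
  refine ⟨σ / (2 * bound σ l), by positivity, max l 1, fun n hn G _ htri hfree => ?_⟩
  have : Nonempty (Fin n) := ⟨⟨0, by omega⟩⟩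
  obtain ⟨P, hP, hlP, hPM, hreg⟩ := szemeredi_regularity G hσ (l := l)
    (by rw [Fintype.card_fin]; omega)
  have hlP' : (l : ℝ) ≤ #P.parts := by exact_mod_cast hlP
  have hedges := two_mul_card_edgeFinset_le hβ.le hσ hP hreg
    (hl.trans (mul_le_mul_of_nonneg_left hlP' hβ.le))
  have hno (L : List (Finset (Fin n))) : ¬ CliqueScheme (pairType G P σ β) L 9 := by
    intro h
    -- The triangle condition is required for every index, so sets that are not parts get the
    -- default `univ`.
    let C : Finset (Fin n) → Finset (Fin n) := fun A => if A ∈ P.parts then A else univ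
    obtain ⟨s, hs, -⟩ := h.exists_isNClique (G := G) (C := C) hσ hβ hβ1
      (fun A B hAB => by
        have hmem := mem_parts_of_one_le_pairType hAB
        simp only [C, if_pos hmem.1, if_pos hmem.2]
        exact densePair_of_one_le_pairType hσβ hAB)
      (fun A W hW => by
        refine htri W (le_trans ?_ hW)
        rw [div_mul_eq_mul_div, mul_div_assoc]
        refine mul_le_mul_of_nonneg_left ?_ hσ.le
        rw [div_le_iff₀ (by positivity)]
        by_cases hA : A ∈ P.parts
        · simp only [C, if_pos hA]
          have h1 := card_le_two_mul_parts_mul_card hP hA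
          rw [Fintype.card_fin] at h1
          have h2 : 2 * #P.parts * #A ≤ 2 * bound σ l * #A := by gcongr
          have h3 : n ≤ #A * (2 * bound σ l) := by linarith
          exact_mod_cast h3
        · simp only [C, if_neg hA, card_univ, Fintype.card_fin]
          have h1 : 1 ≤ bound σ l := bound_pos σ l
          have h2 : n * 1 ≤ n * (2 * bound σ l) := Nat.mul_le_mul_left _ (by omega)
          rw [mul_one] at h2
          exact_mod_cast h2)
      h.length_le C (fun _ _ => subset_rfl) (fun A _ => by
        have h1 : β ^ 9 ≤ β ^ L.length := pow_le_pow_of_le_one hβ.le hβ1 h.length_le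
        have h2 : 10 * σ = β ^ 9 := by rw [hσdef]; ring
        rw [h2]
        gcongr)
    exact hfree s hs
  have hturan := sum_sum_le pairType_comm pairType_self (pairType_le_three hβ.le) hno P.parts
    (fun A => (#A : ℝ)) (fun A _ => by positivity)
  rw [← Nat.cast_sum, P.sum_card_parts, card_univ, Fintype.card_fin] at hturan
  rw [Fintype.card_fin] at hedges
  have h1 : σ * (n : ℝ) ^ 2 ≤ β * n ^ 2 := by gcongr
  have h2 : β * (n : ℝ) ^ 2 = ε / 8 * n ^ 2 := rfl
  have h3 : 0 ≤ ε * (n : ℝ) ^ 2 := by positivity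
  linarith

/-! ### Passing to the limit -/

section Limit

variable {W : Type*}

theorem RT_mono (n : ℕ) (H : SimpleGraph W) {a b : ℝ} (hab : a ≤ b) : RT n H a ≤ RT n H b := by
  rcases (edgeNumbers n H a).eq_empty_or_nonempty with h | h
  · simp [RT, h]
  · refine csSup_le_csSup (bddAbove_edgeNumbers n H b) h ?_
    rintro e ⟨G, hG, hle, he⟩
    exact ⟨G, hG, hle.trans hab, he⟩

theorem isBoundedUnder_RT (H : SimpleGraph W) (f : ℕ → ℝ) :
    IsBoundedUnder (· ≤ ·) atTop fun n : ℕ => (RT n H (f n) : ℝ) / (n : ℝ) ^ 2 :=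
  isBoundedUnder_of ⟨1, fun n => (RT_div_sq_mem_Icc n H (f n)).2⟩

theorem isCoboundedUnder_RT (H : SimpleGraph W) (f : ℕ → ℝ) :
    IsCoboundedUnder (· ≤ ·) atTop fun n : ℕ => (RT n H (f n) : ℝ) / (n : ℝ) ^ 2 :=
  (isBoundedUnder_of ⟨0, fun n => (RT_div_sq_mem_Icc n H (f n)).1⟩ :
    IsBoundedUnder (· ≥ ·) atTop _).isCoboundedUnder_le

theorem upperDensity_mono (H : SimpleGraph W) {f g : ℕ → ℝ} (hfg : ∀ n, f n ≤ g n) :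
    upperDensity H f ≤ upperDensity H g :=
  limsup_le_limsup (Eventually.of_forall fun n => by
      show (RT n H (f n) : ℝ) / (n : ℝ) ^ 2 ≤ (RT n H (g n) : ℝ) / (n : ℝ) ^ 2
      gcongr
      exact RT_mono n H (hfg n))
    (isCoboundedUnder_RT H f) (isBoundedUnder_RT H g)

theorem upperDensity_nonneg (H : SimpleGraph W) (f : ℕ → ℝ) : 0 ≤ upperDensity H f :=
  le_limsup_of_frequently_le
    (Frequently.of_forall fun n => (RT_div_sq_mem_Icc n H (f n)).1) (isBoundedUnder_RT H f)

theorem upperDensity_le {H : SimpleGraph W} {f : ℕ → ℝ} {ρ : ℝ} (hρ : 0 ≤ ρ) {N : ℕ}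
    (h : ∀ n ≥ N, ∀ G : SimpleGraph (Fin n), H.Free G → (G.indepNum : ℝ) ≤ f n →
      (G.edgeSet.ncard : ℝ) ≤ ρ * n ^ 2) : upperDensity H f ≤ ρ := by
  refine limsup_le_of_le (isCoboundedUnder_RT H f) ?_
  filter_upwards [eventually_ge_atTop N] with n hn
  refine div_le_of_le_mul₀ (by positivity) hρ ?_
  rcases (edgeNumbers n H (f n)).eq_empty_or_nonempty with he | he
  · simp only [RT, he, csSup_empty, Nat.bot_eq_zero, Nat.cast_zero]
    positivity
  · obtain ⟨G, hG, hle, hcard⟩ := Nat.sSup_mem he (bddAbove_edgeNumbers n H (f n))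
    rw [RT, ← hcard]
    exact h n hn G hG hle

theorem exists_upperDensity_le {ε : ℝ} (hε : 0 < ε) (hε1 : ε ≤ 1) :
    ∃ δ : ℝ, 0 < δ ∧
      upperDensity (⊤ : SimpleGraph (Fin 9)) (fun n : ℕ => δ * (Q 3 n : ℝ)) ≤ 3 / 10 + ε := by
  classical
  obtain ⟨c, hc, N, hN⟩ := exists_card_edgeFinset_le_of_cliqueFree_nine hε hε1
  set K : ℕ := ⌈1 / c⌉₊ with hK
  -- `K * c ≥ 1` makes sets of size `c * n` large enough, and `δ * K < 1` gives the contradiction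
  -- with the inverse Ramsey number.
  refine ⟨1 / (K + 1), by positivity, upperDensity_le (N := max N 1) (by positivity)
    fun n hn G hG hle => ?_⟩
  rw [← SimpleGraph.coe_edgeFinset, Set.ncard_coe_finset]
  refine hN n (le_of_max_le_left hn) G (fun W hW => ?_)
    (SimpleGraph.cliqueFree_iff_top_free.2 hG)
  refine exists_triangle_of_indepNum_le (K := K) (le_of_max_le_right hn) ?_ hle ?_
  · rw [div_mul_eq_mul_div, one_mul, div_lt_one (by positivity)]
    linarith
  · have h1 : 1 ≤ (K : ℝ) * c := by
      have := Nat.le_ceil (1 / c)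
      rwa [div_le_iff₀ hc] at this
    have h2 : (n : ℝ) ≤ K * W.card := by
      calc (n : ℝ) = 1 * n := (one_mul _).symm
        _ ≤ K * c * n := by gcongr
        _ = K * (c * n) := mul_assoc _ _ _
        _ ≤ K * W.card := by gcongr
    exact_mod_cast h2

end Limit

end RamseyTuran

/-- The upper Ramsey-Turán density of `K_9` with respect to `o(Q(3, n))`, that is, the limit as
`δ → 0⁺` of the upper densities with respect to `δ * Q(3, n)`, exists and is at most `3 / 10`. -/
theorem mainTheorem2 :
    ∃ ρ : ℝ,
      Tendsto
        (fun δ : ℝ => RamseyTuran.upperDensity (⊤ : SimpleGraph (Fin 9))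
          (fun n : ℕ => δ * (RamseyTuran.Q 3 n : ℝ)))
        (𝓝[>] 0) (𝓝 ρ) ∧
      ρ ≤ 3 / 10 := by
  set F : ℝ → ℝ := fun δ => RamseyTuran.upperDensity (⊤ : SimpleGraph (Fin 9))
    (fun n : ℕ => δ * (RamseyTuran.Q 3 n : ℝ)) with hF
  have hmono : Monotone F := fun δ δ' h =>
    RamseyTuran.upperDensity_mono _ fun n => by gcongr
  have hbdd : BddBelow (F '' Set.Ioi 0) := by
    refine ⟨0, ?_⟩
    rintro _ ⟨δ, -, rfl⟩
    exact RamseyTuran.upperDensity_nonneg _ _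
  -- By monotonicity the one-sided limit is the infimum over positive `δ`, so one good `δ` for each
  -- `ε` suffices.
  refine ⟨sInf (F '' Set.Ioi 0), hmono.tendsto_nhdsGT 0, ?_⟩
  refine le_of_forall_pos_le_add fun ε hε => ?_
  obtain ⟨δ, hδ, hle⟩ := RamseyTuran.exists_upperDensity_le (lt_min hε one_pos) (min_le_right ε 1)
  calc sInf (F '' Set.Ioi 0) ≤ F δ := csInf_le hbdd ⟨δ, hδ, rfl⟩
    _ ≤ 3 / 10 + min ε 1 := hle
    _ ≤ 3 / 10 + ε := by gcongr; exact min_le_left _ _
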